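/- Let $(X,d)$ be a complete separable metric space with its Borel $\sigma$-field, let $\mathcal P(X)$ be the set of probability measures on $X$, and let $\vartheta:\mathbb R_+\to\mathbb R_+$, where $\mathbb R_+=[0,\infty)$. A *convex-concave factorization* of $\vartheta$ is a pair $(\varphi,\psi)$ of strictly increasing continuous functions $\mathbb R_+\to\mathbb R_+$ with $\varphi(0)=\psi(0)=0$, $\varphi$ convex, $\psi$ concave and $\vartheta=\varphi\circ\psi$. It is *minimal* if $\varphi^{-1}\circ\tilde\varphi$ is convex for every convex-concave factorization $(\tilde\varphi,\tilde\psi)$ of $\vartheta$. Let $(\varphi,\psi)$ be a minimal convex-concave factorization of $\vartheta$. For $\mu,\nu\in\mathcal P(X)$ let $\Pi(\mu,\nu)$ be the set of probability measures on $X\times X$ with marginals $\mu$ and $\nu$, and put $$W_\vartheta(\mu,\nu)=\inf\Big\{t>0:\ \inf_{q\in\Pi(\mu,\nu)}\int_{X\times X}\varphi\big(\tfrac1t\psi(d(x,y))\big)\,dq(x,y)\le 1\Big\}\in[0,\infty]\qquad(\inf\emptyset=\infty).$$ Let $\mathcal P_\vartheta(X)$ be the set of $\mu\in\mathcal P(X)$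 such that $\int_X\varphi\big(\tfrac1t\psi(d(x,y))\big)\,d\mu(x)<\infty$ for some $y\in X$ and some $t\in(0,\infty)$. Then: 1. $W_\vartheta(\mu_1,\mu_3)\le W_\vartheta(\mu_1,\mu_2)+W_\vartheta(\mu_2,\mu_3)$ for all $\mu_1,\mu_2,\mu_3\in\mathcal P(X)$; 2. for all $\mu,\nu\in\mathcal P(X)$, $W_\vartheta(\mu,\nu)=0$ if and only if $\mu=\nu$; 3. $W_\vartheta(\mu,\nu)<\infty$ for all $\mu,\nu\in\mathcal P_\vartheta(X)$, and $W_\vartheta$ is a complete metric on $\mathcal P_\vartheta(X)$. -/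

import Mathlib

open MeasureTheory Set
open scoped NNReal ENNReal

namespace CCC

/-- `(φ, ψ)` is a convex-concave factorization of `ϑ : ℝ₊ → ℝ₊`: both functions are strictly
increasing, continuous and vanish at `0`, `φ` is convex, `ψ` is concave, and `ϑ = φ ∘ ψ`. -/
structure IsFactorization (ϑ φ ψ : ℝ≥0 → ℝ≥0) : Prop where
  strictMono_left : StrictMono φ
  strictMono_right : StrictMono ψ
  continuous_left : Continuous φ
  continuous_right : Continuous ψ
  map_zero_left : φ 0 = 0
  map_zero_right : ψ 0 = 0
  convexOn_left : ConvexOn ℝ≥0 univ φ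
  concaveOn_right : ConcaveOn ℝ≥0 univ ψ
  eq_comp : ϑ = φ ∘ ψ

/-- The left factor of a factorization is a bijection of `ℝ₊`, so that `Function.invFun φ` is its
inverse function `φ⁻¹ : ℝ₊ → ℝ₊`. -/
theorem IsFactorization.bijective_left {ϑ φ ψ : ℝ≥0 → ℝ≥0} (h : IsFactorization ϑ φ ψ) :
    Function.Bijective φ := by
  refine ⟨h.strictMono_left.injective, h.continuous_left.surjective ?_ ?_⟩
  · have h1 : 0 < φ 1 := by
      have := h.strictMono_left (zero_lt_one (α := ℝ≥0))
      rwa [h.map_zero_left] at this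
    refine Filter.tendsto_atTop_mono' _ (f₁ := fun x => x * φ 1) ?_
      (Filter.tendsto_id.atTop_mul_const h1)
    filter_upwards [Filter.eventually_ge_atTop (1 : ℝ≥0)] with x hx
    have hx0 : x ≠ 0 := (zero_lt_one.trans_le hx).ne'
    have hc := h.convexOn_left.2 (mem_univ x) (mem_univ 0) (zero_le (a := x⁻¹))
      (zero_le (a := 1 - x⁻¹)) (add_tsub_cancel_of_le (inv_le_one_of_one_le₀ hx))
    simp only [smul_eq_mul, mul_zero, add_zero, h.map_zero_left, inv_mul_cancel₀ hx0] at hc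
    calc x * φ 1 ≤ x * (x⁻¹ * φ x) := mul_le_mul_right hc x
      _ = φ x := by rw [← mul_assoc, mul_inv_cancel₀ hx0, one_mul]
  · rw [Filter.OrderBot.atBot_eq, Filter.tendsto_pure, Filter.eventually_pure]
    exact h.map_zero_left

/-- The factorization `(φ, ψ)` of `ϑ` is minimal: `φ⁻¹ ∘ φ'` is convex for every factorization
`(φ', ψ')` of `ϑ`. -/
structure IsMinimalFactorization (ϑ φ ψ : ℝ≥0 → ℝ≥0) : Prop extends IsFactorization ϑ φ ψ where
  minimal : ∀ φ' ψ' : ℝ≥0 → ℝ≥0, IsFactorization ϑ φ' ψ' →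
    ConvexOn ℝ≥0 univ (Function.invFun φ ∘ φ')

section Wasserstein

variable {X : Type*} [MetricSpace X] [MeasurableSpace X]

/-- The cost `φ (ψ (d x y) / t)`. -/
noncomputable def cost (φ ψ : ℝ≥0 → ℝ≥0) (t : ℝ≥0) (x y : X) : ℝ≥0 :=
  φ (t⁻¹ * ψ (nndist x y))

/-- The set of couplings of `μ` and `ν`: the probability measures on `X × X` with marginals
`μ` and `ν`. -/
def couplings (μ ν : ProbabilityMeasure X) : Set (ProbabilityMeasure (X × X)) :=
  {q | (q : Measure (X × X)).map Prod.fst = (μ : Measure X) ∧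
    (q : Measure (X × X)).map Prod.snd = (ν : Measure X)}

/-- The transport cost `inf_q ∫ φ (ψ (d x y) / t) dq(x, y)` over all couplings `q`. -/
noncomputable def transportCost (φ ψ : ℝ≥0 → ℝ≥0) (t : ℝ≥0) (μ ν : ProbabilityMeasure X) : ℝ≥0∞ :=
  ⨅ q ∈ couplings μ ν, ∫⁻ p, (cost φ ψ t p.1 p.2 : ℝ≥0∞) ∂(q : Measure (X × X))

/-- The `L^ϑ`-Wasserstein distance of two probability measures, for the factorization `(φ, ψ)`
of `ϑ`, as an element of `[0, ∞]` (with `inf ∅ = ∞`). -/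
noncomputable def wasserstein (φ ψ : ℝ≥0 → ℝ≥0) (μ ν : ProbabilityMeasure X) : ℝ≥0∞ :=
  ⨅ t ∈ {t : ℝ≥0 | 0 < t ∧ transportCost φ ψ t μ ν ≤ 1}, (t : ℝ≥0∞)

variable (X) in
/-- The `L^ϑ`-Wasserstein space: the probability measures `μ` on `X` with
`∫ φ (ψ (d x y) / t) dμ(x) < ∞` for some `y ∈ X` and some `t ∈ (0, ∞)`. -/
def wassersteinSpace (φ ψ : ℝ≥0 → ℝ≥0) : Set (ProbabilityMeasure X) :=
  {μ | ∃ y : X, ∃ t : ℝ≥0, 0 < t ∧ (∫⁻ x, (cost φ ψ t x y : ℝ≥0∞) ∂(μ : Measure X)) < ∞}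

end Wasserstein

end CCC

/-!
The function `W` is the transport distance built from the metric `ψ ∘ d` and the Luxemburg norm of
the Young function `φ`. Concavity of `ψ` with `ψ 0 = 0` makes `ψ ∘ d` subadditive along the triangle
inequality (`IsFactorization.right_subadditive`), and convexity of `φ` with `φ 0 = 0` then gives
both the triangle inequality for the Luxemburg unit balls (`lintegral_cost_triangle`) and the gain
`s / t` in cost when the scale grows from `s` to `t` (`lintegral_cost_le_mul`). Because of this gain
no optimal couplings are needed: whenever `W μ ν < t`, some coupling has cost at most `1` at the
scale `t` (`exists_coupling_of_wasserstein_lt`).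

Couplings are glued by disintegration: a sequence of couplings with matching marginals comes from a
Markov chain (`exists_measure_map_eq`, by the Ionescu-Tulcea theorem). With two couplings this gives
the triangle inequality. If `W μ ν = 0`, Markov's inequality (`measure_le_nndist_le`) bounds the
Lévy-Prokhorov distance of `μ` and `ν` by every positive number, so `μ = ν`. Membership in the
Wasserstein space means being at finite distance from a Dirac measure
(`mem_wassersteinSpace_iff`), which yields finiteness of `W` there.

For completeness, take a sequence whose successive distances lie below suitable summable scales, and
a Markov chain `(xₙ)` with these marginals and nearly optimal consecutive couplings. By Markov's
inequality and the Borel-Cantelli lemma the chain is almost surely a Cauchy sequence in `X`. The law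
of its limit is the limit of the sequence: adding up the scales bounds the costs of the pairs
`(xₖ, xₖ₊ₙ)` uniformly in `n`, and Fatou's lemma passes the bound on to the pair of `xₖ` and the
limit (`exists_limit_of_wasserstein_lt`). Compactness of sets of measures plays no role.
-/

open Filter Topology ProbabilityTheory

namespace CCC

/-! ### The cost function -/

section Cost

variable {X : Type*} [MetricSpace X] {ϑ φ ψ : ℝ≥0 → ℝ≥0}

theorem IsFactorization.right_subadditive (h : IsFactorization ϑ φ ψ) (a b : ℝ≥0) :
    ψ (a + b) ≤ ψ a + ψ b := by
  rcases eq_or_ne (a + b) 0 with h0 | h0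
  · simp [h0, h.map_zero_right]
  have hab : a / (a + b) + b / (a + b) = 1 := by rw [← add_div, div_self h0]
  have ha := h.concaveOn_right.2 (mem_univ (a + b)) (mem_univ 0) zero_le zero_le hab
  have hb := h.concaveOn_right.2 (mem_univ 0) (mem_univ (a + b)) zero_le zero_le hab
  simp only [smul_eq_mul, mul_zero, add_zero, zero_add, h.map_zero_right,
    div_mul_cancel₀ _ h0] at ha hb
  calc ψ (a + b) = a / (a + b) * ψ (a + b) + b / (a + b) * ψ (a + b) := by
        rw [← add_mul, hab, one_mul]
    _ ≤ ψ a + ψ b := add_le_add ha hb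

theorem cost_self (h : IsFactorization ϑ φ ψ) (t : ℝ≥0) (x : X) : cost φ ψ t x x = 0 := by
  simp [cost, h.map_zero_left, h.map_zero_right]

theorem cost_comm (φ ψ : ℝ≥0 → ℝ≥0) (t : ℝ≥0) (x y : X) : cost φ ψ t x y = cost φ ψ t y x := by
  simp [cost, nndist_comm]

theorem cost_antitone (h : IsFactorization ϑ φ ψ) {s t : ℝ≥0} (hs : 0 < s) (hst : s ≤ t)
    (x y : X) : cost φ ψ t x y ≤ cost φ ψ s x y := by
  unfold cost
  exact h.strictMono_left.monotone (by gcongr)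

/-- By convexity of `φ` and `φ 0 = 0`, enlarging the scale from `s` to `t` shrinks the cost at least
by the factor `s / t`. -/
theorem cost_le_mul_cost (h : IsFactorization ϑ φ ψ) {s t : ℝ≥0} (hs : 0 < s) (hst : s ≤ t)
    (x y : X) : cost φ ψ t x y ≤ s / t * cost φ ψ s x y := by
  have ht : t ≠ 0 := (hs.trans_le hst).ne'
  have hc := h.convexOn_left.2 (mem_univ (s⁻¹ * ψ (nndist x y))) (mem_univ 0)
    (zero_le (a := s / t)) (zero_le (a := 1 - s / t))
    (add_tsub_cancel_of_le (div_le_one_of_le₀ hst zero_le))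
  simp only [smul_eq_mul, mul_zero, add_zero, h.map_zero_left] at hc
  have he : s / t * (s⁻¹ * ψ (nndist x y)) = t⁻¹ * ψ (nndist x y) := by
    have := hs.ne'
    field_simp
  rwa [he] at hc

theorem cost_triangle (h : IsFactorization ϑ φ ψ) {s t : ℝ≥0} (hs : 0 < s) (ht : 0 < t)
    (x y z : X) :
    cost φ ψ (s + t) x z ≤ s / (s + t) * cost φ ψ s x y + t / (s + t) * cost φ ψ t y z := by
  have h0 : s + t ≠ 0 := (add_pos hs ht).ne'
  refine le_trans ?_ (h.convexOn_left.2 (mem_univ (s⁻¹ * ψ (nndist x y)))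
    (mem_univ (t⁻¹ * ψ (nndist y z))) zero_le zero_le (by rw [← add_div, div_self h0]))
  refine h.strictMono_left.monotone ?_
  calc (s + t)⁻¹ * ψ (nndist x z) ≤ (s + t)⁻¹ * (ψ (nndist x y) + ψ (nndist y z)) := by
        gcongr
        exact (h.strictMono_right.monotone (nndist_triangle x y z)).trans
          (h.right_subadditive _ _)
    _ = _ := by
        have := hs.ne'
        have := ht.ne'
        simp only [smul_eq_mul]
        field_simp

theorem lintegral_cost_le_mul {Ω : Type*} [MeasurableSpace Ω] {P : Measure Ω}
    (h : IsFactorization ϑ φ ψ) {s t : ℝ≥0} (hs : 0 < s) (hst : s ≤ t) (f g : Ω → X) :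
    ∫⁻ ω, cost φ ψ t (f ω) (g ω) ∂P ≤
      (s / t : ℝ≥0) * ∫⁻ ω, cost φ ψ s (f ω) (g ω) ∂P := by
  rw [← lintegral_const_mul' _ _ ENNReal.coe_ne_top]
  refine lintegral_mono fun ω => ?_
  rw [← ENNReal.coe_mul]
  exact ENNReal.coe_le_coe.2 (cost_le_mul_cost h hs hst (f ω) (g ω))

theorem continuous_cost (h : IsFactorization ϑ φ ψ) (t : ℝ≥0) :
    Continuous fun p : X × X => (cost φ ψ t p.1 p.2 : ℝ≥0∞) := by
  have := h.continuous_left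
  have := h.continuous_right
  unfold cost
  exact ENNReal.continuous_coe.comp (by fun_prop)

theorem measurable_cost [MeasurableSpace X] [BorelSpace X] [SecondCountableTopology X]
    (h : IsFactorization ϑ φ ψ) (t : ℝ≥0) :
    Measurable fun p : X × X => (cost φ ψ t p.1 p.2 : ℝ≥0∞) :=
  (continuous_cost h t).measurable

end Cost

/-! ### Costs of pairs of random points -/

section RandomPoints

variable {X Ω : Type*} [MetricSpace X] [MeasurableSpace X] [BorelSpace X]
  [SecondCountableTopology X] [MeasurableSpace Ω] {P : Measure Ω} {ϑ φ ψ : ℝ≥0 → ℝ≥0}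

/-- The triangle inequality for the Luxemburg norm of `ψ ∘ d` on a probability space, in terms of
its unit balls. -/
theorem lintegral_cost_triangle (h : IsFactorization ϑ φ ψ) {s t : ℝ≥0} (hs : 0 < s) (ht : 0 < t)
    {f g k : Ω → X} (hf : Measurable f) (hg : Measurable g)
    (hfg : ∫⁻ ω, cost φ ψ s (f ω) (g ω) ∂P ≤ 1) (hgk : ∫⁻ ω, cost φ ψ t (g ω) (k ω) ∂P ≤ 1) :
    ∫⁻ ω, cost φ ψ (s + t) (f ω) (k ω) ∂P ≤ 1 := by
  have h0 : s + t ≠ 0 := (add_pos hs ht).ne'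
  calc ∫⁻ ω, cost φ ψ (s + t) (f ω) (k ω) ∂P
      ≤ ∫⁻ ω, ((s / (s + t) : ℝ≥0) * (cost φ ψ s (f ω) (g ω) : ℝ≥0∞) +
          (t / (s + t) : ℝ≥0) * (cost φ ψ t (g ω) (k ω) : ℝ≥0∞)) ∂P :=
        lintegral_mono fun ω => by
          rw [← ENNReal.coe_mul, ← ENNReal.coe_mul, ← ENNReal.coe_add]
          exact ENNReal.coe_le_coe.2 (cost_triangle h hs ht (f ω) (g ω) (k ω))
    _ = (s / (s + t) : ℝ≥0) * ∫⁻ ω, cost φ ψ s (f ω) (g ω) ∂P +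
          (t / (s + t) : ℝ≥0) * ∫⁻ ω, cost φ ψ t (g ω) (k ω) ∂P := by
        have hm : Measurable fun ω => (cost φ ψ s (f ω) (g ω) : ℝ≥0∞) :=
          (measurable_cost h s).comp (hf.prodMk hg)
        rw [lintegral_add_left (hm.const_mul _),
          lintegral_const_mul' _ _ ENNReal.coe_ne_top, lintegral_const_mul' _ _ ENNReal.coe_ne_top]
    _ ≤ (s / (s + t) : ℝ≥0) * 1 + (t / (s + t) : ℝ≥0) * 1 := by gcongr
    _ = 1 := by
        rw [mul_one, mul_one, ← ENNReal.coe_add, ← add_div, div_self h0, ENNReal.coe_one]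

/-- Markov's inequality at scale `1`, where the cost integrates to at most `t`. -/
theorem measure_le_nndist_le (h : IsFactorization ϑ φ ψ) {t ε : ℝ≥0} (ht : 0 < t) (ht1 : t ≤ 1)
    (hε : 0 < ε) {f g : Ω → X} (hf : Measurable f) (hg : Measurable g)
    (hfg : ∫⁻ ω, cost φ ψ t (f ω) (g ω) ∂P ≤ 1) :
    P {ω | ε ≤ nndist (f ω) (g ω)} ≤ t / φ (ψ ε) := by
  have hψ : 0 < ψ ε := by simpa [h.map_zero_right] using h.strictMono_right hε
  have hφ : 0 < φ (ψ ε) := by simpa [h.map_zero_left] using h.strictMono_left hψ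
  have h1 : ∫⁻ ω, cost φ ψ 1 (f ω) (g ω) ∂P ≤ t := by
    refine (lintegral_cost_le_mul h ht ht1 f g).trans ?_
    rw [div_one]
    exact (mul_le_mul_right hfg _).trans_eq (mul_one _)
  refine le_trans (measure_mono ?_) ((meas_ge_le_lintegral_div
    ((measurable_cost h 1).comp (hf.prodMk hg)).aemeasurable (ε := (φ (ψ ε) : ℝ≥0∞))
    (by exact_mod_cast hφ.ne') ENNReal.coe_ne_top).trans (ENNReal.div_le_div_right h1 _))
  intro ω hω
  simp only [mem_ofPred_eq, Function.comp_apply, cost, inv_one, one_mul, ENNReal.coe_le_coe] at hω ⊢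
  exact h.strictMono_left.monotone (h.strictMono_right.monotone hω)

end RandomPoints

theorem le_of_forall_nnreal_gt {a b : ℝ≥0∞} (hab : ∀ t : ℝ≥0, b < t → a ≤ t) : a ≤ b := by
  refine le_of_forall_gt_imp_ge_of_dense fun c hc => ?_
  obtain ⟨t, hbt, htc⟩ := ENNReal.lt_iff_exists_nnreal_btwn.1 hc
  exact (hab t hbt).trans htc.le

/-! ### Couplings and the Wasserstein distance -/

section Coupling

variable {X : Type*} [MetricSpace X] [MeasurableSpace X] {ϑ φ ψ : ℝ≥0 → ℝ≥0}

theorem wasserstein_le_of_coupling {μ ν : ProbabilityMeasure X} {t : ℝ≥0} (ht : 0 < t)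
    {q : ProbabilityMeasure (X × X)} (hq : q ∈ couplings μ ν)
    (hc : ∫⁻ p, cost φ ψ t p.1 p.2 ∂(q : Measure (X × X)) ≤ 1) : wasserstein φ ψ μ ν ≤ t :=
  iInf₂_le_of_le t ⟨ht, (iInf₂_le q hq).trans hc⟩ le_rfl

/-- No optimal coupling is needed: at a scale above the Wasserstein distance, the excess cost of a
nearly optimal coupling at a smaller scale is absorbed by convexity. -/
theorem exists_coupling_of_wasserstein_lt (h : IsFactorization ϑ φ ψ) {μ ν : ProbabilityMeasure X}
    {t : ℝ≥0} (ht : wasserstein φ ψ μ ν < t) :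
    ∃ q ∈ couplings μ ν, ∫⁻ p, cost φ ψ t p.1 p.2 ∂(q : Measure (X × X)) ≤ 1 := by
  obtain ⟨s, ⟨hs, hs1⟩, hst⟩ : ∃ s : ℝ≥0, (0 < s ∧ transportCost φ ψ s μ ν ≤ 1) ∧ s < t := by
    simpa [wasserstein, iInf_lt_iff] using ht
  have hts : (1 : ℝ≥0∞) < (t / s : ℝ≥0) := by
    exact_mod_cast (one_lt_div hs).2 hst
  obtain ⟨q, hq, hqs⟩ : ∃ q ∈ couplings μ ν,
      ∫⁻ p, cost φ ψ s p.1 p.2 ∂(q : Measure (X × X)) < (t / s : ℝ≥0) := by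
    simpa only [transportCost, iInf_lt_iff, exists_prop] using hs1.trans_lt hts
  refine ⟨q, hq, (lintegral_cost_le_mul h hs hst.le Prod.fst Prod.snd).trans ?_⟩
  calc ((s / t : ℝ≥0) : ℝ≥0∞) * _ ≤ (s / t : ℝ≥0) * (t / s : ℝ≥0) := by gcongr
    _ = 1 := by
      have := hs.ne'
      have := (hs.trans hst).ne'
      rw [← ENNReal.coe_mul, ← ENNReal.coe_one]
      congr 1
      field_simp

variable [BorelSpace X] [SecondCountableTopology X]

theorem wasserstein_le_of_map {Ω : Type*} [MeasurableSpace Ω] {P : Measure Ω}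
    [IsProbabilityMeasure P] (h : IsFactorization ϑ φ ψ) {μ ν : ProbabilityMeasure X} {t : ℝ≥0}
    (ht : 0 < t) {f g : Ω → X} (hf : Measurable f) (hg : Measurable g)
    (hμ : P.map f = μ) (hν : P.map g = ν)
    (hc : ∫⁻ ω, cost φ ψ t (f ω) (g ω) ∂P ≤ 1) : wasserstein φ ψ μ ν ≤ t := by
  have hfg := hf.prodMk hg
  refine wasserstein_le_of_coupling ht
    (q := ⟨P.map fun ω => (f ω, g ω), Measure.isProbabilityMeasure_map hfg.aemeasurable⟩)
    ⟨?_, ?_⟩ ?_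
  · rw [ProbabilityMeasure.coe_mk, Measure.map_map measurable_fst hfg]
    exact hμ
  · rw [ProbabilityMeasure.coe_mk, Measure.map_map measurable_snd hfg]
    exact hν
  · rwa [ProbabilityMeasure.coe_mk, lintegral_map (measurable_cost h t) hfg]

theorem wasserstein_self (h : IsFactorization ϑ φ ψ) (μ : ProbabilityMeasure X) :
    wasserstein φ ψ μ μ = 0 := by
  refine le_antisymm (ENNReal.le_of_forall_pos_le_add fun ε hε _ => ?_) zero_le
  rw [zero_add]
  exact wasserstein_le_of_map (P := (μ : Measure X)) h hε measurable_id measurable_id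
    Measure.map_id Measure.map_id (by simp [cost_self h])

theorem wasserstein_comm_le (h : IsFactorization ϑ φ ψ) (μ ν : ProbabilityMeasure X) :
    wasserstein φ ψ ν μ ≤ wasserstein φ ψ μ ν := by
  refine le_of_forall_nnreal_gt fun t ht => ?_
  obtain ⟨q, hq, hqt⟩ := exists_coupling_of_wasserstein_lt h ht
  refine wasserstein_le_of_map h (by exact_mod_cast zero_le.trans_lt ht) measurable_snd
    measurable_fst hq.2 hq.1 ?_
  simpa only [cost_comm φ ψ t] using hqt

theorem wasserstein_comm (h : IsFactorization ϑ φ ψ) (μ ν : ProbabilityMeasure X) :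
    wasserstein φ ψ μ ν = wasserstein φ ψ ν μ :=
  le_antisymm (wasserstein_comm_le h ν μ) (wasserstein_comm_le h μ ν)

theorem eq_of_wasserstein_eq_zero (h : IsFactorization ϑ φ ψ) {μ ν : ProbabilityMeasure X}
    (h0 : wasserstein φ ψ μ ν = 0) : μ = ν := by
  have key : levyProkhorovEDist (μ : Measure X) (ν : Measure X) ≤ 0 := by
    refine levyProkhorovEDist_le_of_forall_le _ _ _ fun ε B hε hε' hB => ?_
    lift ε to ℝ≥0 using hε'.ne
    replace hε : 0 < ε := by exact_mod_cast hε
    have hψ : 0 < ψ ε := by simpa [h.map_zero_right] using h.strictMono_right hε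
    have hφ : 0 < φ (ψ ε) := by simpa [h.map_zero_left] using h.strictMono_left hψ
    -- This scale makes the bound `t / φ (ψ ε)` of Markov's inequality at most `ε`.
    set t : ℝ≥0 := min 1 (ε * φ (ψ ε)) with ht_def
    have ht : 0 < t := lt_min one_pos (mul_pos hε hφ)
    obtain ⟨q, ⟨hq1, hq2⟩, hqt⟩ := exists_coupling_of_wasserstein_lt h (μ := μ) (ν := ν) (t := t)
      (by rw [h0]; exact_mod_cast ht)
    have hm := measure_le_nndist_le h ht (min_le_left _ _) hε measurable_fst measurable_snd hqt
    rw [← hq1, ← hq2, Measure.map_apply measurable_fst hB,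
      Measure.map_apply measurable_snd Metric.isOpen_thickening.measurableSet]
    refine (measure_mono (t := Prod.snd ⁻¹' Metric.thickening (ε : ℝ≥0∞).toReal B ∪
      {p | ε ≤ nndist p.1 p.2}) fun p hp => ?_).trans ((measure_union_le _ _).trans ?_)
    · rcases le_or_gt ε (nndist p.1 p.2) with hd | hd
      · exact Or.inr hd
      · refine Or.inl (Metric.mem_thickening_iff.2 ⟨p.1, hp, ?_⟩)
        rw [dist_comm, ENNReal.coe_toReal]
        exact_mod_cast hd
    · gcongr
      refine hm.trans (ENNReal.div_le_of_le_mul ?_)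
      exact_mod_cast min_le_right _ _
  have hdist : dist (LevyProkhorov.ofMeasure μ) (LevyProkhorov.ofMeasure ν) = 0 := by
    rw [LevyProkhorov.dist_probabilityMeasure_def]
    change (levyProkhorovEDist (μ : Measure X) (ν : Measure X)).toReal = 0
    rw [le_antisymm key zero_le, ENNReal.toReal_zero]
  exact congrArg LevyProkhorov.toMeasure (eq_of_dist_eq_zero hdist)

end Coupling

/-! ### Markov chains with prescribed consecutive couplings -/

section Chain

variable {X : Type*} [MeasurableSpace X] [StandardBorelSpace X] [Nonempty X]

/-- The chain that disintegrates the `n`-th coupling along its first coordinate and uses the result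
as the transition kernel from time `n` to time `n + 1`. -/
theorem exists_measure_map_eq (q : ℕ → Measure (X × X)) [∀ n, IsProbabilityMeasure (q n)]
    (hq : ∀ n, (q n).snd = (q (n + 1)).fst) :
    ∃ P : Measure (ℕ → X), IsProbabilityMeasure P ∧
      ∀ n, P.map (fun x => (x n, x (n + 1))) = q n := by
  let κ : (n : ℕ) → Kernel ((i : Finset.Iic n) → X) X := fun n =>
    (q n).condKernel.comap (fun x => x ⟨n, Finset.mem_Iic.2 le_rfl⟩) (by fun_prop)
  let P : Measure (ℕ → X) := Kernel.trajMeasure (X := fun _ => X) (q 0).fst κ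
  refine ⟨P, inferInstanceAs (IsProbabilityMeasure (Kernel.trajMeasure _ _)), ?_⟩
  have hstep (n : ℕ) (hn : P.map (fun x => x n) = (q n).fst) :
      P.map (fun x => (x n, x (n + 1))) = q n := by
    have hc := Kernel.map_frestrictLe_trajMeasure_compProd_eq_map_trajMeasure
      (X := fun _ => X) (μ₀ := (q 0).fst) (κ := κ) (a := n)
    change P.map (Preorder.frestrictLe n) ⊗ₘ κ n =
      P.map (fun x => (Preorder.frestrictLe n x, x (n + 1))) at hc
    let g : ((i : Finset.Iic n) → X) × X → X × X :=
      fun p => (p.1 ⟨n, Finset.mem_Iic.2 le_rfl⟩, p.2)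
    have hg : Measurable g := by fun_prop
    have hc' := congrArg (Measure.map g) hc
    rw [Measure.map_map hg (by fun_prop)] at hc'
    change _ = P.map (fun x => (x n, x (n + 1))) at hc'
    rw [← hc']
    ext s hs
    conv_rhs => rw [← (q n).disintegrate (q n).condKernel]
    rw [Measure.map_apply hg hs, Measure.compProd_apply (hg hs), Measure.compProd_apply hs, ← hn,
      lintegral_map (Kernel.measurable_kernel_prodMk_left hs) (by fun_prop),
      lintegral_map (Kernel.measurable_kernel_prodMk_left (hg hs)) (by fun_prop)]
    rfl
  have hmarg (n : ℕ) : P.map (fun x => x n) = (q n).fst := by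
    induction n with
    | zero =>
      have he : (fun x : ℕ → X => x 0) = (fun y : (i : Finset.Iic 0) → X =>
          y ⟨0, Finset.mem_Iic.2 le_rfl⟩) ∘ Preorder.frestrictLe 0 := rfl
      rw [he, ← Measure.map_map (by fun_prop) (by fun_prop)]
      simp only [P, Kernel.trajMeasure]
      rw [Measure.map_comp _ _ (by fun_prop), Kernel.traj_map_frestrictLe, Kernel.partialTraj_self,
        Measure.id_comp, Measure.map_map (by fun_prop) (by fun_prop)]
      exact Measure.map_id
    | succ n ih =>
      rw [← hq n, ← hstep n ih, Measure.snd, Measure.map_map (by fun_prop) (by fun_prop)]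
      rfl
  exact fun n => hstep n (hmarg n)

end Chain

/-! ### Triangle inequality and finiteness -/

section Triangle

variable {X : Type*} [MetricSpace X] [CompleteSpace X] [SecondCountableTopology X]
  [MeasurableSpace X] [BorelSpace X] {ϑ φ ψ : ℝ≥0 → ℝ≥0}

/-- Gluing of two couplings along their common marginal. -/
theorem exists_gluing {μ₁ μ₂ μ₃ : ProbabilityMeasure X} {q r : ProbabilityMeasure (X × X)}
    (hq : q ∈ couplings μ₁ μ₂) (hr : r ∈ couplings μ₂ μ₃) :
    ∃ P : Measure (ℕ → X), IsProbabilityMeasure P ∧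
      P.map (fun x => (x 0, x 1)) = q ∧ P.map (fun x => (x 1, x 2)) = r := by
  have : Nonempty X := μ₁.nonempty
  -- After time `2` the chain stands still.
  let s : ProbabilityMeasure (X × X) := ⟨(μ₃ : Measure X).map fun x => (x, x),
    Measure.isProbabilityMeasure_map (by fun_prop)⟩
  have hs1 : (s : Measure (X × X)).fst = μ₃ := by
    simp only [s, ProbabilityMeasure.coe_mk, Measure.fst]
    rw [Measure.map_map (by fun_prop) (by fun_prop)]
    exact Measure.map_id
  have hs2 : (s : Measure (X × X)).snd = μ₃ := by
    simp only [s, ProbabilityMeasure.coe_mk, Measure.snd]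
    rw [Measure.map_map (by fun_prop) (by fun_prop)]
    exact Measure.map_id
  let c : ℕ → ProbabilityMeasure (X × X)
    | 0 => q
    | 1 => r
    | _ + 2 => s
  obtain ⟨P, hP, hPc⟩ := exists_measure_map_eq (fun n => (c n : Measure (X × X))) fun n => by
    match n with
    | 0 => exact hq.2.trans hr.1.symm
    | 1 => exact hr.2.trans hs1.symm
    | _ + 2 => exact hs2.trans hs1.symm
  exact ⟨P, hP, hPc 0, hPc 1⟩

theorem wasserstein_triangle (h : IsFactorization ϑ φ ψ) (μ₁ μ₂ μ₃ : ProbabilityMeasure X) :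
    wasserstein φ ψ μ₁ μ₃ ≤ wasserstein φ ψ μ₁ μ₂ + wasserstein φ ψ μ₂ μ₃ := by
  refine ENNReal.le_of_forall_pos_le_add fun ε hε hfin => ?_
  obtain ⟨ha, hb⟩ := ENNReal.add_lt_top.1 hfin
  have hε2 : 0 < ε / 2 := half_pos hε
  have hlt {a : ℝ≥0∞} (ha : a < ∞) : a < (a.toNNReal + ε / 2 : ℝ≥0) := by
    rw [ENNReal.coe_add, ENNReal.coe_toNNReal ha.ne]
    exact ENNReal.lt_add_right ha.ne (by exact_mod_cast hε2.ne')
  obtain ⟨q, hq, hqc⟩ := exists_coupling_of_wasserstein_lt h (hlt ha)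
  obtain ⟨r, hr, hrc⟩ := exists_coupling_of_wasserstein_lt h (hlt hb)
  obtain ⟨P, hP, hPq, hPr⟩ := exists_gluing hq hr
  rw [← hPq, lintegral_map (measurable_cost h _) (by fun_prop)] at hqc
  rw [← hPr, lintegral_map (measurable_cost h _) (by fun_prop)] at hrc
  have hpos (a : ℝ≥0∞) : 0 < a.toNNReal + ε / 2 := add_pos_of_nonneg_of_pos zero_le hε2
  refine (wasserstein_le_of_map (P := P) h (add_pos (hpos _) (hpos _))
    (measurable_pi_apply 0) (measurable_pi_apply 2) ?_ ?_
    (lintegral_cost_triangle h (hpos _) (hpos _) (measurable_pi_apply 0) (measurable_pi_apply 1)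
      hqc hrc)).trans_eq ?_
  · rw [← hq.1, ← hPq, Measure.map_map (by fun_prop) (by fun_prop)]
    rfl
  · rw [← hr.2, ← hPr, Measure.map_map (by fun_prop) (by fun_prop)]
    rfl
  · rw [add_add_add_comm, add_halves, ENNReal.coe_add, ENNReal.coe_add,
      ENNReal.coe_toNNReal ha.ne, ENNReal.coe_toNNReal hb.ne]

end Triangle

section Space

variable {X : Type*} [MetricSpace X] [MeasurableSpace X] [BorelSpace X]
  [SecondCountableTopology X] {ϑ φ ψ : ℝ≥0 → ℝ≥0}

theorem wasserstein_diracProba_lt_top (h : IsFactorization ϑ φ ψ) {μ : ProbabilityMeasure X}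
    {y : X} {t : ℝ≥0} (ht : 0 < t) (hμ : ∫⁻ x, cost φ ψ t x y ∂(μ : Measure X) < ∞) :
    wasserstein φ ψ μ (diracProba y) < ∞ := by
  lift ∫⁻ x, cost φ ψ t x y ∂(μ : Measure X) to ℝ≥0 using hμ.ne with C hC
  have hk : 0 < C + 1 := by positivity
  have hle : t ≤ (C + 1) * t := le_mul_of_one_le_left zero_le le_add_self
  refine (wasserstein_le_of_map (P := (μ : Measure X)) h (mul_pos hk ht) measurable_id
    measurable_const (g := fun _ => y) Measure.map_id ?_ ?_).trans_lt ENNReal.coe_lt_top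
  · simp [Measure.map_const, diracProba]
  · refine (lintegral_cost_le_mul h ht hle id fun _ => y).trans ?_
    simp only [id_eq, ← hC]
    rw [← ENNReal.coe_mul, ← ENNReal.coe_one, ENNReal.coe_le_coe]
    have := ht.ne'
    calc t / ((C + 1) * t) * C = C / (C + 1) := by field_simp
      _ ≤ 1 := div_le_one_of_le₀ le_self_add zero_le

theorem mem_wassersteinSpace_iff (h : IsFactorization ϑ φ ψ) {μ : ProbabilityMeasure X} :
    μ ∈ wassersteinSpace X φ ψ ↔ ∃ y : X, wasserstein φ ψ μ (diracProba y) < ∞ := by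
  refine ⟨fun ⟨y, t, ht, hμ⟩ => ⟨y, wasserstein_diracProba_lt_top h ht hμ⟩, fun ⟨y, hy⟩ => ?_⟩
  obtain ⟨t, ht, -⟩ := ENNReal.lt_iff_exists_nnreal_btwn.1 hy
  obtain ⟨q, hq, hqt⟩ := exists_coupling_of_wasserstein_lt h ht
  refine ⟨y, t, by exact_mod_cast zero_le.trans_lt ht, lt_of_le_of_lt ?_ ENNReal.one_lt_top⟩
  have hy : ∀ᵐ p ∂(q : Measure (X × X)), p.2 = y := by
    have hd : ∀ᵐ z ∂(q : Measure (X × X)).map Prod.snd, z = y := by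
      rw [hq.2]
      exact (ae_dirac_iff (measurableSet_singleton y)).2 rfl
    exact ae_of_ae_map measurable_snd.aemeasurable hd
  have hm : Measurable fun x => (cost φ ψ t x y : ℝ≥0∞) :=
    (measurable_cost h t).comp (measurable_id.prodMk measurable_const)
  rw [← hq.1, lintegral_map hm measurable_fst]
  refine (lintegral_congr_ae ?_).trans_le hqt
  filter_upwards [hy] with p hp
  rw [hp]

theorem wasserstein_lt_top [CompleteSpace X] (h : IsFactorization ϑ φ ψ)
    {μ ν : ProbabilityMeasure X} (hμ : μ ∈ wassersteinSpace X φ ψ)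
    (hν : ν ∈ wassersteinSpace X φ ψ) : wasserstein φ ψ μ ν < ∞ := by
  obtain ⟨y, hy⟩ := (mem_wassersteinSpace_iff h).1 hμ
  obtain ⟨z, hz⟩ := (mem_wassersteinSpace_iff h).1 hν
  have hyz : wasserstein φ ψ (diracProba y) (diracProba z) < ∞ := by
    refine wasserstein_diracProba_lt_top h one_pos (t := 1) ?_
    have hm : Measurable fun x => (cost φ ψ 1 x z : ℝ≥0∞) :=
      (measurable_cost h 1).comp (measurable_id.prodMk measurable_const)
    simp only [diracProba, ProbabilityMeasure.coe_mk]
    rw [lintegral_dirac' _ hm]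
    exact ENNReal.coe_lt_top
  rw [wasserstein_comm h] at hz
  exact (wasserstein_triangle h μ (diracProba y) ν).trans_lt (ENNReal.add_lt_top.2
    ⟨hy, (wasserstein_triangle h _ (diracProba z) ν).trans_lt (ENNReal.add_lt_top.2 ⟨hyz, hz⟩)⟩)

end Space

/-! ### Completeness -/

section Complete

variable {X : Type*} [MetricSpace X] [SecondCountableTopology X]
  [MeasurableSpace X] [BorelSpace X] {ϑ φ ψ : ℝ≥0 → ℝ≥0}

/-- A summable sequence of scales such that random points at successive distances below these scales
almost surely form a Cauchy sequence: Markov's inequality bounds the probability that the `n`-th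
step exceeds `2⁻ⁿ` by `2⁻ⁿ`. -/
noncomputable def scale (φ ψ : ℝ≥0 → ℝ≥0) (n : ℕ) : ℝ≥0 :=
  min ((1 / 2) ^ n) ((1 / 2) ^ n * φ (ψ ((1 / 2) ^ n)))

theorem scale_pos (h : IsFactorization ϑ φ ψ) (n : ℕ) : 0 < scale φ ψ n := by
  have hr : (0 : ℝ≥0) < (1 / 2) ^ n := by positivity
  have hψ : 0 < ψ ((1 / 2) ^ n) := by simpa [h.map_zero_right] using h.strictMono_right hr
  have hφ : 0 < φ (ψ ((1 / 2) ^ n)) := by simpa [h.map_zero_left] using h.strictMono_left hψ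
  exact lt_min hr (mul_pos hr hφ)

theorem ae_cauchySeq_of_lintegral_cost_le (h : IsFactorization ϑ φ ψ) {P : Measure (ℕ → X)}
    (hc : ∀ n, ∫⁻ x, cost φ ψ (scale φ ψ n) (x n) (x (n + 1)) ∂P ≤ 1) :
    ∀ᵐ x ∂P, CauchySeq x := by
  have hmarkov (n : ℕ) : P {x | (1 / 2) ^ n ≤ nndist (x n) (x (n + 1))} ≤
      ((1 / 2) ^ n : ℝ≥0) := by
    refine (measure_le_nndist_le h (scale_pos h n) ((min_le_left _ _).trans
      (pow_le_one₀ zero_le (by norm_num))) (by positivity)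
      (measurable_pi_apply n) (measurable_pi_apply (n + 1)) (hc n)).trans
      (ENNReal.div_le_of_le_mul ?_)
    exact_mod_cast min_le_right _ _
  have hsum : ∑' n, P {x | (1 / 2) ^ n ≤ nndist (x n) (x (n + 1))} ≠ ∞ :=
    ne_top_of_le_ne_top (ENNReal.tsum_coe_ne_top_iff_summable.2
      (NNReal.summable_geometric (by norm_num))) (ENNReal.tsum_le_tsum hmarkov)
  filter_upwards [ae_eventually_notMem hsum] with x hx
  refine cauchySeq_of_summable_dist (Summable.of_norm_bounded_eventually_nat
    (summable_geometric_of_lt_one (r := (1 / 2 : ℝ)) (by norm_num) (by norm_num)) ?_)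
  filter_upwards [hx] with n hn
  have hn' : nndist (x n) (x (n + 1)) < (1 / 2) ^ n := not_le.1 hn
  rw [Real.norm_of_nonneg dist_nonneg]
  exact_mod_cast hn'.le

theorem lintegral_cost_le_of_chain (h : IsFactorization ϑ φ ψ) {P : Measure (ℕ → X)}
    (hc : ∀ n, ∫⁻ x, cost φ ψ ((1 / 2) ^ n) (x n) (x (n + 1)) ∂P ≤ 1) (n k : ℕ) :
    ∫⁻ x, cost φ ψ (2 * (1 / 2) ^ k) (x k) (x (k + n)) ∂P ≤ 1 := by
  induction n generalizing k with
  | zero => simp [cost_self h]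
  | succ n ih =>
    have he : (2 * (1 / 2) ^ k : ℝ≥0) = (1 / 2) ^ k + 2 * (1 / 2) ^ (k + 1) := by
      rw [pow_succ]
      field_simp
      norm_num
    have ih' := ih (k + 1)
    rw [add_right_comm, add_assoc] at ih'
    rw [he]
    exact lintegral_cost_triangle h (by positivity) (by positivity) (measurable_pi_apply k)
      (measurable_pi_apply (k + 1)) (hc k) ih'

variable [CompleteSpace X]

/-- The limit is the law of the almost sure limit of a Markov chain with marginals `u n` whose
consecutive couplings are nearly optimal; Fatou's lemma bounds the distance to it. -/
theorem exists_limit_of_wasserstein_lt (h : IsFactorization ϑ φ ψ) (u : ℕ → ProbabilityMeasure X)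
    (hu : ∀ n, wasserstein φ ψ (u n) (u (n + 1)) < scale φ ψ n) :
    ∃ μ : ProbabilityMeasure X, ∀ k, wasserstein φ ψ (u k) μ ≤ (2 * (1 / 2) ^ k : ℝ≥0) := by
  have : Nonempty X := (u 0).nonempty
  choose q hq hqc using fun n => exists_coupling_of_wasserstein_lt h (hu n)
  obtain ⟨P, hP, hPq⟩ := exists_measure_map_eq (fun n => (q n : Measure (X × X)))
    fun n => (hq n).2.trans (hq (n + 1)).1.symm
  have hPu (n : ℕ) : P.map (fun x => x n) = u n := by
    rw [← (hq n).1, ← hPq n, Measure.map_map (by fun_prop) (by fun_prop)]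
    rfl
  have hc (n : ℕ) : ∫⁻ x, cost φ ψ (scale φ ψ n) (x n) (x (n + 1)) ∂P ≤ 1 := by
    have := hqc n
    rwa [← hPq n, lintegral_map (measurable_cost h _) (by fun_prop)] at this
  have hc' (n : ℕ) : ∫⁻ x, cost φ ψ ((1 / 2) ^ n) (x n) (x (n + 1)) ∂P ≤ 1 :=
    (lintegral_mono fun x => ENNReal.coe_le_coe.2
      (cost_antitone h (scale_pos h n) (min_le_left _ _) _ _)).trans (hc n)
  obtain ⟨g, hg, hlim⟩ := measurable_limit_of_tendsto_metrizable_ae (μ := P) (L := atTop)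
    (f := fun n (x : ℕ → X) => x n) (fun n => (measurable_pi_apply n).aemeasurable)
    ((ae_cauchySeq_of_lintegral_cost_le h hc).mono fun x hx => cauchySeq_tendsto_of_complete hx)
  refine ⟨⟨P.map g, Measure.isProbabilityMeasure_map hg.aemeasurable⟩, fun k => ?_⟩
  refine wasserstein_le_of_map h (by positivity) (measurable_pi_apply k) hg (hPu k) rfl ?_
  set t : ℝ≥0 := 2 * (1 / 2) ^ k with ht
  have hlim' : ∀ᵐ x ∂P, Tendsto (fun n => (cost φ ψ t (x k) (x (k + n)) : ℝ≥0∞)) atTop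
      (𝓝 (cost φ ψ t (x k) (g x))) := by
    filter_upwards [hlim] with x hx
    have hx' : Tendsto (fun n => x (k + n)) atTop (𝓝 (g x)) := by
      simpa only [add_comm k] using (tendsto_add_atTop_iff_nat k).2 hx
    exact ((continuous_cost h t).tendsto (x k, g x)).comp (tendsto_const_nhds.prodMk_nhds hx')
  calc ∫⁻ x, cost φ ψ t (x k) (g x) ∂P
      = ∫⁻ x, liminf (fun n => (cost φ ψ t (x k) (x (k + n)) : ℝ≥0∞)) atTop ∂P :=
        lintegral_congr_ae (hlim'.mono fun x hx => hx.liminf_eq.symm)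
    _ ≤ liminf (fun n => ∫⁻ x, cost φ ψ t (x k) (x (k + n)) ∂P) atTop :=
        lintegral_liminf_le fun n => (measurable_cost h t).comp
          ((measurable_pi_apply k).prodMk (measurable_pi_apply (k + n)))
    _ ≤ liminf (fun _ : ℕ => (1 : ℝ≥0∞)) atTop :=
        liminf_le_liminf (Eventually.of_forall fun n => lintegral_cost_le_of_chain h hc' n k)
    _ = 1 := liminf_const 1

/-- The Wasserstein distance as a metric on the Wasserstein space. -/
@[reducible]
noncomputable def wassersteinMetric (h : IsFactorization ϑ φ ψ) :
    MetricSpace (wassersteinSpace X φ ψ) where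
  dist μ ν := (wasserstein φ ψ (μ : ProbabilityMeasure X) ν).toReal
  dist_self μ := by simp [wasserstein_self h]
  dist_comm μ ν := by rw [wasserstein_comm h]
  dist_triangle μ ν ρ := by
    rw [← ENNReal.toReal_add (wasserstein_lt_top h μ.2 ν.2).ne (wasserstein_lt_top h ν.2 ρ.2).ne]
    exact ENNReal.toReal_mono (ENNReal.add_ne_top.2
      ⟨(wasserstein_lt_top h μ.2 ν.2).ne, (wasserstein_lt_top h ν.2 ρ.2).ne⟩)
      (wasserstein_triangle h _ _ _)
  eq_of_dist_eq_zero {μ ν} h0 := Subtype.ext <| eq_of_wasserstein_eq_zero h <|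
    ((ENNReal.toReal_eq_zero_iff _).1 h0).resolve_right (wasserstein_lt_top h μ.2 ν.2).ne

theorem completeSpace_wassersteinMetric (h : IsFactorization ϑ φ ψ) :
    @CompleteSpace (wassersteinSpace X φ ψ)
      (wassersteinMetric h).toPseudoMetricSpace.toUniformSpace := by
  let _ := wassersteinMetric (X := X) h
  refine Metric.complete_of_convergent_controlled_sequences (fun n => (scale φ ψ n : ℝ))
    (fun n => by exact_mod_cast scale_pos h n) fun u hu => ?_
  obtain ⟨μ, hμ⟩ := exists_limit_of_wasserstein_lt h (fun n => (u n : ProbabilityMeasure X))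
    fun n => by
      have := hu n n (n + 1) le_rfl n.le_succ
      rw [← ENNReal.ofReal_coe_nnreal]
      exact (ENNReal.lt_ofReal_iff_toReal_lt (wasserstein_lt_top h (u n).2 (u (n + 1)).2).ne).2
        this
  have hmem : μ ∈ wassersteinSpace X φ ψ := by
    obtain ⟨y, hy⟩ := (mem_wassersteinSpace_iff h).1 (u 0).2
    refine (mem_wassersteinSpace_iff h).2 ⟨y, (wasserstein_triangle h μ (u 0) _).trans_lt
      (ENNReal.add_lt_top.2 ⟨?_, hy⟩)⟩
    rw [wasserstein_comm h]
    exact (hμ 0).trans_lt ENNReal.coe_lt_top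
  refine ⟨⟨μ, hmem⟩, tendsto_iff_dist_tendsto_zero.2 (squeeze_zero (fun _ => dist_nonneg)
    (g := fun n => 2 * (1 / 2 : ℝ) ^ n) (fun n => ?_) ?_)⟩
  · have hn : dist (u n) ⟨μ, hmem⟩ ≤ ((2 * (1 / 2) ^ n : ℝ≥0) : ℝ≥0∞).toReal :=
      ENNReal.toReal_mono ENNReal.coe_ne_top (hμ n)
    simpa using hn
  · simpa using (tendsto_pow_atTop_nhds_zero_of_lt_one (r := (1 / 2 : ℝ)) (by norm_num)
      (by norm_num)).const_mul 2

end Complete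

end CCC

theorem mainTheorem2 {X : Type*} [MetricSpace X] [CompleteSpace X]
    [TopologicalSpace.SeparableSpace X] [MeasurableSpace X] [BorelSpace X]
    (ϑ φ ψ : ℝ≥0 → ℝ≥0) (h : CCC.IsMinimalFactorization ϑ φ ψ) :
    (∀ μ₁ μ₂ μ₃ : ProbabilityMeasure X,
      CCC.wasserstein φ ψ μ₁ μ₃ ≤ CCC.wasserstein φ ψ μ₁ μ₂ + CCC.wasserstein φ ψ μ₂ μ₃) ∧
    (∀ μ ν : ProbabilityMeasure X, CCC.wasserstein φ ψ μ ν = 0 ↔ μ = ν) ∧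
    (∀ μ ∈ CCC.wassersteinSpace X φ ψ, ∀ ν ∈ CCC.wassersteinSpace X φ ψ,
      CCC.wasserstein φ ψ μ ν < ∞) ∧
    ∃ m : MetricSpace (CCC.wassersteinSpace X φ ψ),
      (∀ μ ν : CCC.wassersteinSpace X φ ψ,
        m.dist μ ν = (CCC.wasserstein φ ψ (μ : ProbabilityMeasure X) ν).toReal) ∧
      @CompleteSpace (CCC.wassersteinSpace X φ ψ)
        m.toPseudoMetricSpace.toUniformSpace := by
  have hf := h.toIsFactorization
  have := UniformSpace.secondCountable_of_separable X
  exact ⟨CCC.wasserstein_triangle hf,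
    fun μ ν => ⟨CCC.eq_of_wasserstein_eq_zero hf, fun hμν => hμν ▸ CCC.wasserstein_self hf μ⟩,
    fun μ hμ ν hν => CCC.wasserstein_lt_top hf hμ hν,
    CCC.wassersteinMetric hf, fun _ _ => rfl, CCC.completeSpace_wassersteinMetric hf⟩
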